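/- For a real number $\theta$ let $A_\theta$ be the universal unital C*-algebra generated by two unitaries $U_\theta,V_\theta$ with $U_\theta V_\theta=e^{2\pi i\theta}V_\theta U_\theta$. For an integer $n\ge 1$ and an integer $p$ let $u_{p/n}\in M_n(\mathbb C)$ be the cyclic shift matrix (ones on the superdiagonal and in the lower-left corner, zeros elsewhere; $u_{p/1}=(1)$) and $v_{p/n}=\mathrm{diag}(1,\omega,\dots,\omega^{n-1})$, $\omega=e^{2\pi i p/n}$. For $\varepsilon>0$ and an element $T$ of a unital C*-algebra (for matrices, with the operator norm) the $\varepsilon$-pseudospectrum is $\sigma^{(\varepsilon)}(T)=\{\lambda\in\mathbb C:\|(\lambda-T)^{-1}\|\ge 1/\varepsilon\}$, with $\|(\lambda-T)^{-1}\|=\infty$ if $\lambda-T$ is not invertible; $\sigma(T)$ is the spectrum. Let $\alpha_1,\alpha_{-1},\beta_1,\beta_{-1}\in\mathbb C$ and $M=\max\{|\alpha_1|,|\alpha_{-1}|,|\beta_1|,|\beta_{-1}|\}$. There is a constant $C_1$ with $0\le C_1\le 36M\sqrt{3\pi}$ such that the following holds for every irrational $\theta\in(0,1)$ and all integers $p_n$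 ($n\ge1$) with $|\theta-\frac{p_n}{n}|\le\frac1{2n}$. Put $$H_\theta=\alpha_1U_\theta+\alpha_{-1}U_\theta^*+\beta_1V_\theta+\beta_{-1}V_\theta^*\in A_\theta,\qquad h_n=\alpha_1u_{p_n/n}+\alpha_{-1}u_{p_n/n}^*+\beta_1v_{p_n/n}+\beta_{-1}v_{p_n/n}^*\in M_n(\mathbb C).$$ Then for every $n\ge 1$: 1. for every $\varepsilon>0$, $\sigma^{(\varepsilon)}(h_n)\subset\sigma^{(\varepsilon+C_1/\sqrt n)}(H_\theta)$; 2. if $M>0$ and $H_\theta$ is normal, then for every $\lambda\in\sigma(h_n)$ there is $\mu\in\sigma(H_\theta)$ with $|\lambda-\mu|<C_1/\sqrt n$. -/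

import Mathlib

open scoped Matrix.Norms.L2Operator

universe u

noncomputable section

/-- A pair of unitaries `U`, `V` with `U V = e^{2πiθ} V U` in a nonzero unital C⋆-algebra. -/
structure RotationPair (θ : ℝ) : Type (u + 1) where
  carrier : Type u
  [cstar : CStarAlgebra carrier]
  [nontriv : Nontrivial carrier]
  U : carrier
  V : carrier
  unitary_U : U ∈ unitary carrier
  unitary_V : V ∈ unitary carrier
  rel : U * V = Complex.exp (2 * Real.pi * Complex.I * θ) • (V * U)

attribute [instance] RotationPair.cstar RotationPair.nontriv

/-- The bounded families (`ℓ^∞`-product, with the sup norm) over all rotation pairs. -/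
abbrev RotationProduct (θ : ℝ) : Type (u + 1) :=
  lp (fun R : RotationPair.{u} θ => R.carrier) ⊤

instance instCStarAlgebraRotationProduct (θ : ℝ) : CStarAlgebra (RotationProduct.{u} θ) where

theorem norm_le_one_of_mem_unitary {B : Type u} [CStarAlgebra B] [Nontrivial B] {x : B}
    (hx : x ∈ unitary B) : ‖x‖ ≤ 1 :=
  (CStarRing.norm_of_mem_unitary hx).le

/-- The family of all the first unitaries. -/
def RotationProduct.U (θ : ℝ) : RotationProduct.{u} θ :=
  ⟨fun R => R.U, memℓp_infty ⟨1, by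
    rintro _ ⟨R, rfl⟩
    exact norm_le_one_of_mem_unitary R.unitary_U⟩⟩

/-- The family of all the second unitaries. -/
def RotationProduct.V (θ : ℝ) : RotationProduct.{u} θ :=
  ⟨fun R => R.V, memℓp_infty ⟨1, by
    rintro _ ⟨R, rfl⟩
    exact norm_le_one_of_mem_unitary R.unitary_V⟩⟩

/-- The rotation algebra `A_θ`: the universal unital C⋆-algebra generated by two unitaries
`U`, `V` with `U V = e^{2πiθ} V U`, built as the C⋆-algebra generated by the two universal
families in the product over all such pairs.  Its defining property is
`RotationAlgebra.universal` below. -/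
abbrev RotationAlgebra (θ : ℝ) : Type (u + 1) :=
  (StarAlgebra.adjoin ℂ {RotationProduct.U.{u} θ, RotationProduct.V.{u} θ}).topologicalClosure

instance instCStarAlgebraRotationAlgebra (θ : ℝ) : CStarAlgebra (RotationAlgebra.{u} θ) :=
  StarSubalgebra.cstarAlgebra _
    (h_closed := StarSubalgebra.isClosed_topologicalClosure _)

namespace RotationAlgebra

/-- The first canonical generator `U_θ`. -/
def U (θ : ℝ) : RotationAlgebra.{u} θ :=
  ⟨RotationProduct.U θ, StarSubalgebra.le_topologicalClosure _
    (StarAlgebra.subset_adjoin ℂ _ (by simp))⟩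

/-- The second canonical generator `V_θ`. -/
def V (θ : ℝ) : RotationAlgebra.{u} θ :=
  ⟨RotationProduct.V θ, StarSubalgebra.le_topologicalClosure _
    (StarAlgebra.subset_adjoin ℂ _ (by simp))⟩

theorem U_mem_unitary (θ : ℝ) : U.{u} θ ∈ unitary (RotationAlgebra.{u} θ) := by
  rw [Unitary.mem_iff]
  constructor <;> apply Subtype.ext <;> apply lp.ext <;> funext R
  · exact (Unitary.mem_iff.mp R.unitary_U).1
  · exact (Unitary.mem_iff.mp R.unitary_U).2

theorem V_mem_unitary (θ : ℝ) : V.{u} θ ∈ unitary (RotationAlgebra.{u} θ) := by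
  rw [Unitary.mem_iff]
  constructor <;> apply Subtype.ext <;> apply lp.ext <;> funext R
  · exact (Unitary.mem_iff.mp R.unitary_V).1
  · exact (Unitary.mem_iff.mp R.unitary_V).2

theorem U_mul_V (θ : ℝ) :
    U.{u} θ * V θ = Complex.exp (2 * Real.pi * Complex.I * θ) • (V θ * U θ) := by
  apply Subtype.ext
  apply lp.ext
  funext R
  exact R.rel

/-- Evaluation at a rotation pair, as a `⋆`-homomorphism. -/
def eval {θ : ℝ} (R : RotationPair.{u} θ) : RotationAlgebra.{u} θ →⋆ₐ[ℂ] R.carrier where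
  toFun x := x.1 R
  map_one' := rfl
  map_mul' _ _ := rfl
  map_zero' := rfl
  map_add' _ _ := rfl
  commutes' _ := rfl
  map_star' _ := rfl

theorem hom_ext {θ : ℝ} {B : Type*} [CStarAlgebra B] {φ ψ : RotationAlgebra.{u} θ →⋆ₐ[ℂ] B}
    (hU : φ (U θ) = ψ (U θ)) (hV : φ (V θ) = ψ (V θ)) : φ = ψ := by
  have hc : ∀ χ : RotationAlgebra.{u} θ →⋆ₐ[ℂ] B, Continuous χ := fun χ =>
    (AddMonoidHomClass.lipschitz_of_bound χ 1 fun x => by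
      simpa using NonUnitalStarAlgHom.norm_apply_le χ x).continuous
  apply StarAlgHom.ext_topologicalClosure (hc φ) (hc ψ)
  apply StarAlgHom.ext_adjoin
  rintro ⟨x, hx⟩ h
  rcases h with rfl | rfl
  · exact hU
  · exact hV

/-- The universal property of `A_θ`. -/
theorem universal {θ : ℝ} {B : Type u} [CStarAlgebra B] {a b : B}
    (ha : a ∈ unitary B) (hb : b ∈ unitary B)
    (hab : a * b = Complex.exp (2 * Real.pi * Complex.I * θ) • (b * a)) :
    ∃! φ : RotationAlgebra.{u} θ →⋆ₐ[ℂ] B, φ (U θ) = a ∧ φ (V θ) = b := by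
  refine existsUnique_of_exists_of_unique ?_ ?_
  · rcases subsingleton_or_nontrivial B with hB | hB
    · exact ⟨{ toFun := fun _ => 0
               map_one' := Subsingleton.elim _ _
               map_mul' := fun _ _ => Subsingleton.elim _ _
               map_zero' := rfl
               map_add' := fun _ _ => Subsingleton.elim _ _
               commutes' := fun _ => Subsingleton.elim _ _
               map_star' := fun _ => Subsingleton.elim _ _ },
        Subsingleton.elim _ _, Subsingleton.elim _ _⟩
    · exact ⟨eval ⟨B, a, b, ha, hb, hab⟩, rfl, rfl⟩
  · rintro φ ψ ⟨h1, h2⟩ ⟨h3, h4⟩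
    exact hom_ext (h1.trans h3.symm) (h2.trans h4.symm)

/-- `H_θ = α₁ U_θ + α₋₁ U_θ* + β₁ V_θ + β₋₁ V_θ*` (`α₋₁`, `β₋₁` are written with a prime). -/
def H (θ : ℝ) (α₁ α₁' β₁ β₁' : ℂ) : RotationAlgebra.{u} θ :=
  α₁ • U θ + α₁' • star (U θ) + β₁ • V θ + β₁' • star (V θ)

end RotationAlgebra

namespace MatrixModel

/-- The `n × n` cyclic shift: ones on the superdiagonal and in the lower left corner. -/
def shift (n : ℕ) : Matrix (Fin n) (Fin n) ℂ :=
  Matrix.of fun i j => if (j : ℕ) = ((i : ℕ) + 1) % n then 1 else 0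

/-- The `n × n` diagonal matrix `diag(1, ω, …, ω^{n-1})` with `ω = e^{2πip/n}`. -/
def clock (n : ℕ) (p : ℤ) : Matrix (Fin n) (Fin n) ℂ :=
  Matrix.diagonal fun i => Complex.exp (2 * Real.pi * Complex.I * ((p : ℂ) / (n : ℂ))) ^ (i : ℕ)

/-- The matrix model `α₁ u + α₁' u* + β₁ v + β₁' v*` at `p / n`. -/
def h (n : ℕ) (p : ℤ) (α₁ α₁' β₁ β₁' : ℂ) : Matrix (Fin n) (Fin n) ℂ :=
  α₁ • shift n + α₁' • star (shift n) + β₁ • clock n p + β₁' • star (clock n p)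

end MatrixModel

/-- The `ε`-pseudospectrum `{λ : ‖(λ - a)⁻¹‖ ≥ 1/ε}` (used for `ε > 0`), where
`‖(λ - a)⁻¹‖ = ∞` if `λ - a` is not invertible, i.e. if `λ` is in the spectrum of `a`. -/
def pseudospectrum {A : Type*} [NormedRing A] [NormedAlgebra ℂ A] (ε : ℝ) (a : A) : Set ℂ :=
  {z | z ∈ spectrum ℂ a ∨ 1 / ε ≤ ‖resolvent a z‖}

/-- `Λ ⊂^δ S`: each point of `Λ` has distance less than `δ` from some point of `S`. -/
def SubsetWithin (δ : ℝ) (Λ S : Set ℂ) : Prop :=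
  ∀ z ∈ Λ, ∃ w ∈ S, ‖z - w‖ < δ

end

/-! ### Weighted permutations of `ℓ²(ι, E)` -/

section WeightedPermutation

/-! Let `a`, `b` be unitaries on E = ℂⁿ satisfying the rotation relation for s = p/n. On ℓ²(ℤ, E),
the shift tensored with `a` and the diagonal phase e^{2πi(θ-s)m} tensored with `b` satisfy it for θ,
so they carry a representation φ of A_θ. For a slowly varying window w on ℤ, the map J x = w ⊗ x
almost intertwines the two models. With a triangular window of width about k, the shift costs O(1/k)
and the phase O(k|θ - s|). Since |θ - s| ≤ 1/(2n), taking k ≈ √n makes both O(1/√n), and φ(H_θ) J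
differs from J h_n by at most 20M/√n relative to ‖w‖. Approximate eigenvectors of h_n thus become
approximate eigenvectors of φ(H_θ) and bound the resolvent of H_θ from below
(`norm_le_resolvent_of_intertwine`, `exists_intertwine`). This gives the pseudospectral inclusion.
For normal H_θ the resolvent norm is controlled by the distance to the spectrum, which gives the
second claim. -/

theorem norm_lp_two_sq {ι E : Type*} [NormedAddCommGroup E] (f : lp (fun _ : ι => E) 2) :
    ‖f‖ ^ 2 = ∑' i, ‖f i‖ ^ 2 := by
  simpa using lp.norm_rpow_eq_tsum (p := 2) (by norm_num) f

variable {ι : Type*} {E : Type*} [NormedAddCommGroup E] [InnerProductSpace ℂ E]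

theorem memℓp_weightedPerm (d : ι → E ≃ₗᵢ[ℂ] E) (e : ι ≃ ι) (f : lp (fun _ : ι => E) 2) :
    Memℓp (fun i => d i (f (e i))) 2 := by
  have h := (lp.memℓp f).summable (by norm_num)
  refine memℓp_gen ?_
  simpa [Function.comp_def] using e.summable_iff.mpr h

/-- The isometry `f ↦ (i ↦ d i (f (e i)))` of `ℓ²(ι, E)`. -/
noncomputable def weightedPerm (d : ι → E ≃ₗᵢ[ℂ] E) (e : ι ≃ ι) :
    lp (fun _ : ι => E) 2 ≃ₗᵢ[ℂ] lp (fun _ : ι => E) 2 where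
  toFun f := ⟨fun i => d i (f (e i)), memℓp_weightedPerm d e f⟩
  invFun f := ⟨fun i => (d (e.symm i)).symm (f (e.symm i)),
    memℓp_weightedPerm (fun i => (d (e.symm i)).symm) e.symm f⟩
  map_add' f g := by apply lp.ext; funext i; exact map_add (d i) _ _
  map_smul' c f := by apply lp.ext; funext i; exact map_smul (d i) _ _
  left_inv f := by apply lp.ext; funext i; simp
  right_inv f := by apply lp.ext; funext i; simp
  norm_map' f := by
    refine (sq_eq_sq₀ (norm_nonneg _) (norm_nonneg _)).mp ?_
    rw [norm_lp_two_sq, norm_lp_two_sq, ← e.tsum_eq fun i => ‖f i‖ ^ 2]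
    exact tsum_congr fun i => by simp

/-- The map `x ↦ (i ↦ w i • x)` from `E` to `ℓ²(ι, E)`, for a square-summable weight `w`. -/
noncomputable def weightEmbedding (w : lp (fun _ : ι => ℂ) 2) : E →ₗ[ℂ] lp (fun _ : ι => E) 2 where
  toFun x := ⟨fun i => w i • x, by
    refine memℓp_gen ?_
    simpa [norm_smul, mul_pow] using
      ((lp.memℓp w).summable (p := 2) (by norm_num)).mul_right (‖x‖ ^ (2 : ℝ))⟩
  map_add' x y := by apply lp.ext; funext i; exact smul_add _ _ _
  map_smul' c x := by apply lp.ext; funext i; exact smul_comm _ _ _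

theorem weightEmbedding_apply (w : lp (fun _ : ι => ℂ) 2) (x : E) (i : ι) :
    weightEmbedding w x i = w i • x := rfl

theorem norm_weightEmbedding (w : lp (fun _ : ι => ℂ) 2) (x : E) :
    ‖weightEmbedding w x‖ = ‖w‖ * ‖x‖ := by
  refine (sq_eq_sq₀ (norm_nonneg _) (by positivity)).mp ?_
  rw [mul_pow, norm_lp_two_sq, norm_lp_two_sq, ← tsum_mul_right]
  exact tsum_congr fun i => by rw [weightEmbedding_apply, norm_smul, mul_pow]

end WeightedPermutation

/-! ### Transfer of approximate eigenvectors -/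

section Transfer

variable {E K : Type*} [NormedAddCommGroup E] [InnerProductSpace ℂ E] [NormedAddCommGroup K]
  [InnerProductSpace ℂ K] [CompleteSpace K]

/-- Adjoints inherit the bound because `A` is isometric: A(A*J x - J a*x) = J x - A J(a*x), which is
the original defect at the vector a*x, of the same norm as x. -/
theorem norm_star_intertwine_le [CompleteSpace E] {a : E →L[ℂ] E} {A : K →L[ℂ] K}
    (ha : a ∈ unitary (E →L[ℂ] E)) (hA : A ∈ unitary (K →L[ℂ] K)) (J : E →ₗ[ℂ] K) {c : ℝ}
    (h : ∀ x, ‖A (J x) - J (a x)‖ ≤ c * ‖x‖) (x : E) :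
    ‖star A (J x) - J (star a x)‖ ≤ c * ‖x‖ := by
  have h1 : A (star A (J x)) = J x := congr($(Unitary.mul_star_self_of_mem hA) (J x))
  have h2 : a (star a x) = x := congr($(Unitary.mul_star_self_of_mem ha) x)
  have h3 : ‖star a x‖ = ‖x‖ :=
    (star a).norm_map_of_mem_unitary (Unitary.star_mem ha) x
  have h4 := h (star a x)
  rw [h2, h3] at h4
  rw [← A.norm_map_of_mem_unitary hA, map_sub, h1, norm_sub_rev]
  exact h4

theorem norm_combination_intertwine_le [CompleteSpace E] {a b : E →L[ℂ] E} {A B : K →L[ℂ] K}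
    (ha : a ∈ unitary (E →L[ℂ] E)) (hb : b ∈ unitary (E →L[ℂ] E))
    (hA : A ∈ unitary (K →L[ℂ] K)) (hB : B ∈ unitary (K →L[ℂ] K)) (J : E →ₗ[ℂ] K) {c d M : ℝ}
    (hc : ∀ x, ‖A (J x) - J (a x)‖ ≤ c * ‖x‖) (hd : ∀ x, ‖B (J x) - J (b x)‖ ≤ d * ‖x‖)
    {α α' β β' : ℂ} (hα : ‖α‖ ≤ M) (hα' : ‖α'‖ ≤ M) (hβ : ‖β‖ ≤ M) (hβ' : ‖β'‖ ≤ M) (x : E) :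
    ‖(α • A + α' • star A + β • B + β' • star B) (J x) -
      J ((α • a + α' • star a + β • b + β' • star b) x)‖ ≤ 2 * M * (c + d) * ‖x‖ := by
  have key : ∀ {γ : ℂ} {y : K} {r : ℝ}, ‖γ‖ ≤ M → ‖y‖ ≤ r → ‖γ • y‖ ≤ M * r := by
    intro γ y r h1 h2
    rw [norm_smul]
    exact mul_le_mul h1 h2 (norm_nonneg _) ((norm_nonneg _).trans h1)
  have e : (α • A + α' • star A + β • B + β' • star B) (J x) -
      J ((α • a + α' • star a + β • b + β' • star b) x) =
      α • (A (J x) - J (a x)) + α' • (star A (J x) - J (star a x)) +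
        β • (B (J x) - J (b x)) + β' • (star B (J x) - J (star b x)) := by
    simp only [add_apply, smul_apply, map_add, map_smul,
      smul_sub]
    abel
  rw [e]
  refine (norm_add_le_of_le (norm_add_le_of_le (norm_add_le_of_le (key hα (hc x))
    (key hα' (norm_star_intertwine_le ha hA J hc x))) (key hβ (hd x)))
    (key hβ' (norm_star_intertwine_le hb hB J hd x))).trans (le_of_eq (by ring))

/-- Apply φ(resolvent) to (z - φ(T)) J x to recover J x. As φ is contractive, only the resolvent
norm in the abstract algebra enters, and the scale `s` of J cancels. -/
theorem norm_le_resolvent_of_intertwine {A : Type*} [CStarAlgebra A] (φ : A →⋆ₐ[ℂ] (K →L[ℂ] K))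
    {T : A} {z : ℂ} (hz : z ∉ spectrum ℂ T) (J : E →ₗ[ℂ] K) (t : E →L[ℂ] E) {s c : ℝ} (hs : 0 < s)
    (hJ : ∀ x, ‖J x‖ = s * ‖x‖) (h : ∀ x, ‖φ T (J x) - J (t x)‖ ≤ c * s * ‖x‖) (x : E) :
    ‖x‖ ≤ ‖resolvent T z‖ * (‖z • x - t x‖ + c * ‖x‖) := by
  have h1 : resolvent T z * (algebraMap ℂ A z - T) = 1 :=
    Ring.inverse_mul_cancel _ (spectrum.notMem_iff.mp hz)
  have h2 : φ (resolvent T z) (z • J x - φ T (J x)) = J x := by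
    have := congr(φ $h1 (J x))
    rw [map_mul, map_sub, map_one, AlgHomClass.commutes, Algebra.algebraMap_eq_smul_one] at this
    simpa using this
  have h3 : ‖z • J x - φ T (J x)‖ ≤ s * ‖z • x - t x‖ + c * s * ‖x‖ := by
    have e : z • J x - φ T (J x) = J (z • x - t x) - (φ T (J x) - J (t x)) := by
      rw [map_sub, map_smul]; abel
    rw [e, ← hJ]
    exact norm_sub_le_of_le le_rfl (h x)
  have h4 : s * ‖x‖ ≤ ‖resolvent T z‖ * (s * ‖z • x - t x‖ + c * s * ‖x‖) := by
    have h5 := (φ (resolvent T z)).le_opNorm (z • J x - φ T (J x))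
    rw [h2, hJ] at h5
    refine h5.trans ?_
    exact mul_le_mul (NonUnitalStarAlgHom.norm_apply_le φ _) h3 (norm_nonneg _) (norm_nonneg _)
  refine le_of_mul_le_mul_left (h4.trans (le_of_eq (by ring))) hs

end Transfer

/-- By continuous functional calculus the resolvent is the function (z - w)⁻¹ of T, bounded by 1/r
on the spectrum. -/
theorem norm_resolvent_le_of_normal {A : Type*} [CStarAlgebra A] {T : A} [hT : IsStarNormal T]
    {z : ℂ} {r : ℝ} (hr : 0 < r) (h : ∀ w ∈ spectrum ℂ T, r ≤ ‖z - w‖) :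
    z ∉ spectrum ℂ T ∧ ‖resolvent T z‖ ≤ 1 / r := by
  have hne : ∀ w ∈ spectrum ℂ T, z - w ≠ 0 := fun w hw => norm_pos_iff.mp (hr.trans_le (h w hw))
  refine ⟨fun hz => hne z hz (sub_self z), ?_⟩
  have e : resolvent T z = cfc (fun w => (z - w)⁻¹) T := by
    rw [cfc_inv (fun w => z - w) T hne, cfc_sub (fun _ => z) (fun w => w) T, cfc_const z T,
      cfc_id' ℂ T]
    rfl
  rw [e]
  refine norm_cfc_le (by positivity) fun w hw => ?_
  rw [norm_inv, one_div]
  exact inv_anti₀ hr (h w hw)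

/-! ### A slowly varying window on `ℤ` -/

/-- The triangular window of height `2 * k`, supported on `[-2 * k, 2 * k]`. -/
def triangle (k : ℕ) (m : ℤ) : ℝ := ((max 0 (2 * (k : ℤ) - |m|) : ℤ) : ℝ)

theorem triangle_eq_zero {k : ℕ} {m : ℤ} (h : 2 * (k : ℤ) ≤ |m|) : triangle k m = 0 := by
  rw [triangle, max_eq_left (by omega), Int.cast_zero]

theorem natCast_le_triangle {k : ℕ} {m : ℤ} (h : |m| ≤ (k : ℤ)) : (k : ℝ) ≤ triangle k m := by
  unfold triangle
  have : (k : ℤ) ≤ max 0 (2 * (k : ℤ) - |m|) := by omega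
  exact_mod_cast this

theorem abs_triangle_sub_le (k : ℕ) (m : ℤ) : |triangle k (m + 1) - triangle k m| ≤ 1 := by
  unfold triangle
  have : |max 0 (2 * (k : ℤ) - |m + 1|) - max 0 (2 * (k : ℤ) - |m|)| ≤ 1 := by
    rcases abs_cases (m + 1) with h | h <;> rcases abs_cases m with h' | h' <;>
    rw [abs_le] <;> omega
  exact_mod_cast this

theorem triangle_sub_eq_zero {k : ℕ} {m : ℤ} (h : m ∉ Finset.Ico (-(2 * (k : ℤ))) (2 * k)) :
    triangle k (m + 1) - triangle k m = 0 := by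
  rw [Finset.mem_Ico] at h
  rw [triangle_eq_zero, triangle_eq_zero, sub_zero] <;>
    first
      | (rcases abs_cases m with h' | h' <;> omega)
      | (rcases abs_cases (m + 1) with h' | h' <;> omega)

/-- The triangular window as an element of `ℓ²`. -/
noncomputable def triangleWeight (k : ℕ) : lp (fun _ : ULift.{u} ℤ => ℂ) 2 :=
  ⟨fun i => (triangle k i.down : ℂ), memℓp_gen <| by
    refine Equiv.ulift.symm.summable_iff.mp (summable_of_ne_finset_zero
      (s := Finset.Ico (-(2 * (k : ℤ))) (2 * k)) fun m hm => ?_)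
    rw [Finset.mem_Ico] at hm
    have : triangle k m = 0 :=
      triangle_eq_zero (by rcases abs_cases m with h' | h' <;> omega)
    simp [this]⟩

theorem triangleWeight_apply (k : ℕ) (i : ULift.{u} ℤ) :
    triangleWeight.{u} k i = (triangle k i.down : ℂ) := rfl

/-- Only the 2k + 1 points with |m| ≤ k are counted, each contributing at least k². -/
theorem two_mul_cube_le_norm_triangleWeight_sq (k : ℕ) :
    2 * (k : ℝ) ^ 3 ≤ ‖triangleWeight.{u} k‖ ^ 2 := by
  have h := lp.sum_rpow_le_norm_rpow (p := 2) (by norm_num) (triangleWeight.{u} k)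
    ((Finset.Icc (-(k : ℤ)) k).map Equiv.ulift.symm.toEmbedding)
  simp only [Finset.sum_map, ENNReal.toReal_ofNat, Real.rpow_ofNat] at h
  refine le_trans ?_ h
  have h1 : (Finset.Icc (-(k : ℤ)) k).card • (k : ℝ) ^ 2 ≤ ∑ m ∈ Finset.Icc (-(k : ℤ)) k,
      ‖triangleWeight.{u} k (Equiv.ulift.symm.toEmbedding m)‖ ^ 2 := by
    refine Finset.card_nsmul_le_sum _ _ _ fun m hm => ?_
    rw [Finset.mem_Icc] at hm
    have h2 := natCast_le_triangle (abs_le.mpr hm)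
    rw [triangleWeight_apply, Complex.norm_real, Real.norm_eq_abs, sq_abs]
    exact pow_le_pow_left₀ (by positivity) h2 2
  refine le_trans ?_ h1
  have h3 : (Finset.Icc (-(k : ℤ)) k).card = 2 * k + 1 := by
    rw [Int.card_Icc]; omega
  rw [h3, nsmul_eq_mul]
  push_cast
  nlinarith [sq_nonneg (k : ℝ)]

/-- The translation of `ℤ` by one. -/
def uliftSucc : ULift.{u} ℤ ≃ ULift.{u} ℤ :=
  (Equiv.ulift.trans (Equiv.addRight 1)).trans Equiv.ulift.symm

theorem uliftSucc_down (i : ULift.{u} ℤ) : (uliftSucc i).down = i.down + 1 := rfl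

/-- The difference lives on 4k points and has modulus at most 1 at each. -/
theorem norm_shift_triangleWeight_sub_sq_le (k : ℕ) (f : lp (fun _ : ULift.{u} ℤ => ℂ) 2)
    (hf : ∀ i, f i = triangleWeight k (uliftSucc i) - triangleWeight k i) :
    ‖f‖ ^ 2 ≤ 4 * k := by
  have hf' : ∀ m : ℤ, ‖f (Equiv.ulift.symm m)‖ = |triangle k (m + 1) - triangle k m| := by
    intro m
    rw [hf, triangleWeight_apply, triangleWeight_apply, ← Complex.ofReal_sub, Complex.norm_real,
      Real.norm_eq_abs]
    rfl
  rw [norm_lp_two_sq, ← Equiv.ulift.symm.tsum_eq,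
    tsum_eq_sum (s := Finset.Ico (-(2 * (k : ℤ))) (2 * k)) fun m hm => by
      rw [hf', triangle_sub_eq_zero hm]; simp]
  refine (Finset.sum_le_card_nsmul _ _ 1 fun m _ => ?_).trans (le_of_eq ?_)
  · rw [hf']
    exact pow_le_one₀ (abs_nonneg _) (abs_triangle_sub_le k m)
  · have h3 : (Finset.Ico (-(2 * (k : ℤ))) (2 * k)).card = 4 * k := by
      rw [Int.card_Ico]; omega
    rw [h3]; simp

/-! ### The representation of the rotation algebra on `ℓ²(ℤ, E)` -/

/-- The unimodular number `e^{it}`. -/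
noncomputable def phase (t : ℝ) : unitary ℂ :=
  ⟨Complex.exp (Complex.I * t), by
    rw [Unitary.mem_iff_star_mul_self, Complex.star_def, ← Complex.normSq_eq_conj_mul_self,
      Complex.normSq_eq_norm_sq, mul_comm, Complex.norm_exp_ofReal_mul_I]
    simp⟩

section Representation

variable {E : Type} [NormedAddCommGroup E] [InnerProductSpace ℂ E]

/-- The operator `f ↦ (m ↦ a (f (m + 1)))` on `ℓ²(ℤ, E)`. -/
noncomputable def shiftOp (a : E ≃ₗᵢ[ℂ] E) :
    lp (fun _ : ULift.{u} ℤ => E) 2 ≃ₗᵢ[ℂ] lp (fun _ : ULift.{u} ℤ => E) 2 :=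
  weightedPerm (fun _ => a) uliftSucc

/-- The operator `f ↦ (m ↦ e^{2πiδm} b (f m))` on `ℓ²(ℤ, E)`. -/
noncomputable def phaseOp (δ : ℝ) (b : E ≃ₗᵢ[ℂ] E) :
    lp (fun _ : ULift.{u} ℤ => E) 2 ≃ₗᵢ[ℂ] lp (fun _ : ULift.{u} ℤ => E) 2 :=
  weightedPerm (fun i => phase (2 * Real.pi * δ * i.down) • b) (Equiv.refl _)

theorem shiftOp_apply (a : E ≃ₗᵢ[ℂ] E) (f : lp (fun _ : ULift.{u} ℤ => E) 2) (i : ULift.{u} ℤ) :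
    shiftOp a f i = a (f (uliftSucc i)) := rfl

theorem phaseOp_apply (δ : ℝ) (b : E ≃ₗᵢ[ℂ] E) (f : lp (fun _ : ULift.{u} ℤ => E) 2)
    (i : ULift.{u} ℤ) :
    phaseOp δ b f i = Complex.exp (Complex.I * (2 * Real.pi * δ * i.down : ℝ)) • b (f i) := rfl

/-- Passing from m to m + 1 contributes e^{2πi(θ-s)}, which corrects the factor e^{2πis} of the pair
on E to e^{2πiθ}. -/
theorem shiftOp_phaseOp {a b : E ≃ₗᵢ[ℂ] E} {s θ : ℝ}
    (hab : ∀ x, a (b x) = Complex.exp (2 * Real.pi * Complex.I * s) • b (a x))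
    (f : lp (fun _ : ULift.{u} ℤ => E) 2) :
    shiftOp a (phaseOp (θ - s) b f) =
      Complex.exp (2 * Real.pi * Complex.I * θ) • phaseOp (θ - s) b (shiftOp a f) := by
  apply lp.ext
  funext i
  rw [lp.coeFn_smul, Pi.smul_apply, shiftOp_apply, phaseOp_apply, phaseOp_apply, shiftOp_apply,
    map_smul, hab, smul_smul, smul_smul, ← Complex.exp_add, ← Complex.exp_add, uliftSucc_down]
  congr 2
  push_cast
  ring

theorem norm_shiftOp_intertwine_le (a : E ≃ₗᵢ[ℂ] E) {k : ℕ} (hk : 1 ≤ k) (x : E) :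
    ‖shiftOp a (weightEmbedding (triangleWeight.{u} k) x) -
      weightEmbedding (triangleWeight k) (a x)‖ ≤
      3 / (2 * k) * ‖triangleWeight.{u} k‖ * ‖x‖ := by
  let g : lp (fun _ : ULift.{u} ℤ => ℂ) 2 :=
    weightedPerm (fun _ => LinearIsometryEquiv.refl ℂ ℂ) uliftSucc (triangleWeight.{u} k) -
      triangleWeight k
  have hg : ‖g‖ ^ 2 ≤ 4 * k := norm_shift_triangleWeight_sub_sq_le k g fun i => rfl
  have e : shiftOp a (weightEmbedding (triangleWeight.{u} k) x) -
      weightEmbedding (triangleWeight k) (a x) = weightEmbedding g (a x) := by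
    apply lp.ext
    funext i
    have h1 : g i = triangleWeight k (uliftSucc i) - triangleWeight k i := rfl
    rw [lp.coeFn_sub, Pi.sub_apply, shiftOp_apply, weightEmbedding_apply, weightEmbedding_apply,
      weightEmbedding_apply, map_smul, h1, sub_smul]
  rw [e, norm_weightEmbedding, a.norm_map]
  refine mul_le_mul_of_nonneg_right ?_ (norm_nonneg _)
  have hk' : (0 : ℝ) < k := by exact_mod_cast hk
  refine (sq_le_sq₀ (norm_nonneg _) (by positivity)).mp (hg.trans ?_)
  have h2 := two_mul_cube_le_norm_triangleWeight_sq.{u} k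
  -- The constant 3/2 is a rational majorant of √2 = √(4k / 2k³) · k.
  have h3 : (3 / (2 * (k : ℝ))) ^ 2 * (2 * (k : ℝ) ^ 3) = 9 / 2 * k := by field_simp; norm_num
  rw [mul_pow]
  calc 4 * (k : ℝ) ≤ 9 / 2 * k := by linarith
    _ = _ := h3.symm
    _ ≤ _ := mul_le_mul_of_nonneg_left h2 (by positivity)

/-- The window vanishes for |m| ≥ 2k, and for |m| ≤ 2k the phase differs from 1 by at most 2π|δ| ·
2k. -/
theorem norm_phaseOp_intertwine_le (δ : ℝ) (b : E ≃ₗᵢ[ℂ] E) (k : ℕ) (x : E) :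
    ‖phaseOp δ b (weightEmbedding (triangleWeight.{u} k) x) -
      weightEmbedding (triangleWeight k) (b x)‖ ≤
      4 * Real.pi * |δ| * k * ‖triangleWeight.{u} k‖ * ‖x‖ := by
  have e : 4 * Real.pi * |δ| * k * ‖triangleWeight.{u} k‖ * ‖x‖ =
      ‖((4 * Real.pi * |δ| * k : ℝ) : ℂ) • weightEmbedding (triangleWeight.{u} k) (b x)‖ := by
    have := Real.pi_pos
    rw [norm_smul, norm_weightEmbedding, b.norm_map, Complex.norm_real,
      Real.norm_of_nonneg (by positivity)]
    ring
  rw [e]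
  refine lp.norm_mono two_ne_zero fun i => ?_
  rw [lp.coeFn_sub, Pi.sub_apply, lp.coeFn_smul, Pi.smul_apply, phaseOp_apply,
    weightEmbedding_apply, weightEmbedding_apply, map_smul]
  obtain ⟨y, hy⟩ : ∃ y, y = (triangleWeight.{u} k i : ℂ) • b x := ⟨_, rfl⟩
  rw [← hy]
  have h1 : Complex.exp (Complex.I * (2 * Real.pi * δ * i.down : ℝ)) • y - y =
      (Complex.exp (Complex.I * (2 * Real.pi * δ * i.down : ℝ)) - 1) • y := by
    rw [sub_smul, one_smul]
  have := Real.pi_pos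
  rw [h1, norm_smul, norm_smul, Complex.norm_real, Real.norm_of_nonneg (by positivity)]
  rcases le_or_gt (2 * (k : ℤ)) |i.down| with h | h
  · have : y = 0 := by rw [hy, triangleWeight_apply, triangle_eq_zero h]; simp
    simp [this]
  · refine mul_le_mul_of_nonneg_right ?_ (norm_nonneg _)
    refine Real.norm_exp_I_mul_ofReal_sub_one_le.trans ?_
    have h2 : |(i.down : ℝ)| ≤ 2 * k := by exact_mod_cast h.le
    rw [Real.norm_eq_abs, abs_mul, abs_mul, abs_of_pos (by positivity : 0 < 2 * Real.pi)]
    calc 2 * Real.pi * |δ| * |(i.down : ℝ)| ≤ 2 * Real.pi * |δ| * (2 * k) := by gcongr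
      _ = _ := by ring

/-- The rotation pair on `ℓ²(ℤ, E)` built from a pair of unitaries on `E` for another parameter. -/
noncomputable def tensorPair [CompleteSpace E] [Nontrivial E] {s : ℝ} (θ : ℝ)
    (a b : unitary (E →L[ℂ] E))
    (hab : (a * b : E →L[ℂ] E) = Complex.exp (2 * Real.pi * Complex.I * s) • (b * a : E →L[ℂ] E)) :
    RotationPair.{u} θ where
  -- `ULift` places the Hilbert space, hence its operator algebra, in the universe over which A_θ is
  -- universal.
  carrier := lp (fun _ : ULift.{u} ℤ => E) 2 →L[ℂ] lp (fun _ : ULift.{u} ℤ => E) 2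
  nontriv := by
    obtain ⟨x, hx⟩ := exists_ne (0 : E)
    have : Nontrivial (lp (fun _ : ULift.{u} ℤ => E) 2) :=
      ⟨lp.single 2 ⟨0⟩ x, 0, fun h => hx (by simpa using congr($h ⟨0⟩))⟩
    infer_instance
  U := Unitary.linearIsometryEquiv.symm (shiftOp (Unitary.linearIsometryEquiv a))
  V := Unitary.linearIsometryEquiv.symm (phaseOp (θ - s) (Unitary.linearIsometryEquiv b))
  unitary_U := SetLike.coe_mem _
  unitary_V := SetLike.coe_mem _
  rel := by
    ext1 f
    exact shiftOp_phaseOp (fun x => DFunLike.congr_fun hab x) f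

/-- The size of the error made when a rotation pair is replaced by one for the parameter `s`. -/
theorem exists_intertwine [CompleteSpace E] [Nontrivial E] {s θ M : ℝ} {a b : E →L[ℂ] E}
    (ha : a ∈ unitary (E →L[ℂ] E)) (hb : b ∈ unitary (E →L[ℂ] E))
    (hab : a * b = Complex.exp (2 * Real.pi * Complex.I * s) • (b * a))
    {n : ℕ} (hn : 1 ≤ n) (hs : |θ - s| ≤ 1 / (2 * (n : ℝ)))
    {α α' β β' : ℂ} (hα : ‖α‖ ≤ M) (hα' : ‖α'‖ ≤ M) (hβ : ‖β‖ ≤ M) (hβ' : ‖β'‖ ≤ M)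
    {z : ℂ} (hz : z ∉ spectrum ℂ (RotationAlgebra.H.{u} θ α α' β β')) (x : E) :
    ‖x‖ ≤ ‖resolvent (RotationAlgebra.H.{u} θ α α' β β') z‖ *
      (‖z • x - (α • a + α' • star a + β • b + β' • star b) x‖ +
        20 * M / Real.sqrt n * ‖x‖) := by
  -- This choice balances the shift error 3/(2k) against the phase error, at most 2πk/n.
  obtain ⟨k, hk⟩ : ∃ k, k = Nat.sqrt n := ⟨_, rfl⟩
  have hk1 : 1 ≤ k := by rw [hk]; exact Nat.sqrt_pos.mpr hn
  have hk0 : (1 : ℝ) ≤ k := by exact_mod_cast hk1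
  have hkn : (k : ℝ) ≤ Real.sqrt n := by
    refine Real.le_sqrt_of_sq_le ?_
    rw [hk]
    exact_mod_cast Nat.sqrt_le' n
  have hnk : Real.sqrt n ≤ 2 * k := by
    have h1 : (n : ℝ) ≤ (k + 1) ^ 2 := by
      rw [hk]; exact_mod_cast (Nat.lt_succ_sqrt' n).le
    exact (Real.sqrt_le_iff.mpr ⟨by positivity, h1⟩).trans (by linarith)
  have hr : 0 < Real.sqrt n := by linarith
  have hM : 0 ≤ M := (norm_nonneg _).trans hα
  have hw : 0 < ‖triangleWeight.{u} k‖ := by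
    have := two_mul_cube_le_norm_triangleWeight_sq.{u} k
    have h3 : (0 : ℝ) < 2 * (k : ℝ) ^ 3 := by positivity
    exact (sq_pos_iff.mp (h3.trans_le this)).symm.lt_of_le (norm_nonneg _)
  have h1 : 3 / (2 * (k : ℝ)) ≤ 3 / Real.sqrt n := by gcongr
  have h2 : 4 * Real.pi * |θ - s| * k ≤ 7 / Real.sqrt n := by
    have hpi := Real.pi_lt_d2
    have hn' : (n : ℝ) = Real.sqrt n * Real.sqrt n := (Real.mul_self_sqrt (by positivity)).symm
    calc 4 * Real.pi * |θ - s| * k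
        ≤ 4 * Real.pi * (1 / (2 * (n : ℝ))) * Real.sqrt n := by
          have := Real.pi_pos
          gcongr
      _ = 2 * Real.pi / Real.sqrt n := by
          nth_rewrite 1 [hn']; field_simp; norm_num
      _ ≤ 7 / Real.sqrt n := by gcongr; linarith
  let P := tensorPair.{u} θ ⟨a, ha⟩ ⟨b, hb⟩ hab
  refine norm_le_resolvent_of_intertwine
    (K := lp (fun _ : ULift.{u} ℤ => E) 2) (RotationAlgebra.eval P) hz
    (weightEmbedding (triangleWeight.{u} k)) _ hw (norm_weightEmbedding _) (fun y => ?_) x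
  -- The errors 3/√n and 7/√n (from 2π < 7) combine to 2M(3 + 7)/√n = 20M/√n.
  refine (norm_combination_intertwine_le (M := M)
    (c := 3 / Real.sqrt n * ‖triangleWeight.{u} k‖) (d := 7 / Real.sqrt n * ‖triangleWeight.{u} k‖)
    ha hb P.unitary_U P.unitary_V _
    (fun y => (norm_shiftOp_intertwine_le _ hk1 y).trans (by gcongr))
    (fun y => (norm_phaseOp_intertwine_le _ _ k y).trans (by gcongr)) hα hα' hβ hβ' y).trans
    (le_of_eq (by ring))

end Representation

/-! ### The clock and shift matrices -/

namespace MatrixModel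

/-- The successor modulo `n`. -/
def rotate {n : ℕ} (i : Fin n) : Fin n := ⟨((i : ℕ) + 1) % n, Nat.mod_lt _ i.pos⟩

theorem rotate_injective (n : ℕ) : Function.Injective (rotate : Fin n → Fin n) := by
  intro i j h
  have h1 : ((i : ℕ) + 1) % n = ((j : ℕ) + 1) % n := congr(($h : ℕ))
  have h2 : (i : ℕ) ≡ j [MOD n] := Nat.ModEq.add_right_cancel' 1 h1
  exact Fin.ext (Nat.ModEq.eq_of_lt_of_lt h2 i.isLt j.isLt)

theorem shift_apply {n : ℕ} (i j : Fin n) : shift n i j = if j = rotate i then 1 else 0 := by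
  simp [shift, rotate, Fin.ext_iff]

theorem shift_mem_unitary (n : ℕ) : shift n ∈ unitary (Matrix (Fin n) (Fin n) ℂ) := by
  refine Matrix.mem_unitaryGroup_iff.mpr ?_
  ext i j
  rw [Matrix.mul_apply, Matrix.one_apply]
  simp [Matrix.star_apply, shift_apply, (rotate_injective n).eq_iff, eq_comm]

theorem clock_mem_unitary (n : ℕ) (p : ℤ) : clock n p ∈ unitary (Matrix (Fin n) (Fin n) ℂ) := by
  refine Matrix.mem_unitaryGroup_iff.mpr ?_
  have h : ‖Complex.exp (2 * Real.pi * Complex.I * ((p : ℂ) / (n : ℂ)))‖ = 1 := by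
    rw [show 2 * Real.pi * Complex.I * ((p : ℂ) / (n : ℂ)) =
      ((2 * Real.pi * (p / n) : ℝ) : ℂ) * Complex.I by push_cast; ring]
    exact Complex.norm_exp_ofReal_mul_I _
  rw [clock, Matrix.star_eq_conjTranspose, Matrix.diagonal_conjTranspose,
    Matrix.diagonal_mul_diagonal, ← Matrix.diagonal_one]
  congr 1
  funext i
  rw [Pi.star_apply, Complex.star_def, Complex.mul_conj', norm_pow, h]
  simp

theorem shift_mul_clock {n : ℕ} (hn : 1 ≤ n) (p : ℤ) :
    shift n * clock n p =
      Complex.exp (2 * Real.pi * Complex.I * ((p : ℂ) / (n : ℂ))) • (clock n p * shift n) := by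
  have hω : Complex.exp (2 * Real.pi * Complex.I * ((p : ℂ) / (n : ℂ))) ^ n = 1 := by
    rw [← Complex.exp_nat_mul, Complex.exp_eq_one_iff]
    refine ⟨p, ?_⟩
    have : (n : ℂ) ≠ 0 := by exact_mod_cast (by omega : n ≠ 0)
    field_simp
  ext i j
  rw [clock, Matrix.mul_diagonal, Matrix.smul_apply, Matrix.diagonal_mul, shift_apply]
  split_ifs with h
  -- ωⁿ = 1 removes the reduction mod n, so the wrap-around row needs no separate case.
  · rw [h, rotate, ← pow_eq_pow_mod _ hω, pow_succ]
    simp [mul_comm]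
  · simp

/-- A lower bound for the resolvent of `H_θ` given by the vectors of the matrix model. -/
theorem norm_le_resolvent_H {α α' β β' : ℂ} {M θ : ℝ} {p : ℤ} {n : ℕ} (hn : 1 ≤ n)
    (hp : |θ - (p : ℝ) / (n : ℝ)| ≤ 1 / (2 * (n : ℝ)))
    (hα : ‖α‖ ≤ M) (hα' : ‖α'‖ ≤ M) (hβ : ‖β‖ ≤ M) (hβ' : ‖β'‖ ≤ M)
    {z : ℂ} (hz : z ∉ spectrum ℂ (RotationAlgebra.H.{u} θ α α' β β'))
    (x : EuclideanSpace ℂ (Fin n)) :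
    ‖x‖ ≤ ‖resolvent (RotationAlgebra.H.{u} θ α α' β β') z‖ *
      (‖Matrix.toEuclideanCLM (𝕜 := ℂ) (algebraMap ℂ _ z - h n p α α' β β') x‖ +
        20 * M / Real.sqrt n * ‖x‖) := by
  have : Nonempty (Fin n) := ⟨⟨0, hn⟩⟩
  let F := Matrix.toEuclideanCLM (n := Fin n) (𝕜 := ℂ)
  have hab : F (shift n) * F (clock n p) =
      Complex.exp (2 * Real.pi * Complex.I * ((p / n : ℝ) : ℂ)) •
        (F (clock n p) * F (shift n)) := by
    rw [← map_mul, shift_mul_clock hn, map_smul, map_mul]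
    push_cast
    rfl
  have key := exists_intertwine.{u} (Unitary.map_mem F (shift_mem_unitary n))
    (Unitary.map_mem F (clock_mem_unitary n p)) hab hn hp hα hα' hβ hβ' hz x
  have e : F (algebraMap ℂ _ z - h n p α α' β β') x = z • x - (α • F (shift n) +
      α' • star (F (shift n)) + β • F (clock n p) + β' • star (F (clock n p))) x := by
    rw [h, map_sub, map_add, map_add, map_add, map_smul, map_smul, map_smul, map_smul, map_star,
      map_star, Algebra.algebraMap_eq_smul_one, map_smul, map_one]
    rfl
  rw [← e] at key
  exact key

end MatrixModel

/-! ### Passage from vector estimates to pseudospectra and spectra -/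

theorem Matrix.isUnit_of_toEuclideanCLM_injective {n : Type*} [Fintype n] [DecidableEq n]
    {A : Matrix n n ℂ} (hA : ∀ x, Matrix.toEuclideanCLM (𝕜 := ℂ) A x = 0 → x = 0) : IsUnit A := by
  refine Matrix.mulVec_injective_iff_isUnit.mp ?_
  refine (injective_iff_map_eq_zero A.mulVecLin).mpr fun v hv => ?_
  have := hA (WithLp.toLp 2 v) (by
    rw [Matrix.toEuclideanCLM_toLp]
    exact congrArg _ hv)
  exact congr(WithLp.ofLp $this)

/-- With r the resolvent norm of H_θ at z and c = 20M/√n, failure of the conclusion gives r(ε + c) <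
1. Then z - h_n is bounded below, hence invertible, with inverse of norm at most r/(1 - rc) < 1/ε.
-/
theorem pseudospectrum_h_subset {α α' β β' : ℂ} {M C θ ε : ℝ} {p : ℤ} {n : ℕ} (hn : 1 ≤ n)
    (hp : |θ - (p : ℝ) / (n : ℝ)| ≤ 1 / (2 * (n : ℝ)))
    (hα : ‖α‖ ≤ M) (hα' : ‖α'‖ ≤ M) (hβ : ‖β‖ ≤ M) (hβ' : ‖β'‖ ≤ M)
    (hC : 20 * M ≤ C) (hε : 0 < ε) :
    pseudospectrum ε (MatrixModel.h n p α α' β β') ⊆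
      pseudospectrum (ε + C / Real.sqrt n) (RotationAlgebra.H.{u} θ α α' β β') := by
  intro z hz
  by_contra hcon
  obtain ⟨h1, h2⟩ : z ∉ spectrum ℂ (RotationAlgebra.H.{u} θ α α' β β') ∧
      ‖resolvent (RotationAlgebra.H.{u} θ α α' β β') z‖ < 1 / (ε + C / Real.sqrt n) := by
    simpa [pseudospectrum, not_or] using hcon
  have key := MatrixModel.norm_le_resolvent_H.{u} hn hp hα hα' hβ hβ' h1
  set r := ‖resolvent (RotationAlgebra.H.{u} θ α α' β β') z‖ with hr
  have hr0 : 0 ≤ r := norm_nonneg _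
  have hM : 0 ≤ M := (norm_nonneg _).trans hα
  set c := 20 * M / Real.sqrt n with hc
  have hc0 : 0 ≤ c := by positivity
  have hcC : c ≤ C / Real.sqrt n := by rw [hc]; gcongr
  have h3 : r * (ε + c) < 1 := by
    rw [lt_div_iff₀ (by linarith)] at h2
    nlinarith
  have h4 : 0 < 1 - r * c := by nlinarith
  set A := algebraMap ℂ (Matrix (Fin n) (Fin n) ℂ) z - MatrixModel.h n p α α' β β' with hA
  have h5 : ∀ x, (1 - r * c) * ‖x‖ ≤ r * ‖Matrix.toEuclideanCLM (𝕜 := ℂ) A x‖ := fun x => by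
    linarith [key x]
  have hu : IsUnit A := Matrix.isUnit_of_toEuclideanCLM_injective fun x hx => by
    have := h5 x
    rw [hx, norm_zero, mul_zero] at this
    exact norm_eq_zero.mp (le_antisymm (nonpos_of_mul_nonpos_right this h4) (norm_nonneg _))
  rcases hz with hz | hz
  · exact hz hu
  · have h6 : ‖resolvent (MatrixModel.h n p α α' β β') z‖ ≤ r / (1 - r * c) := by
      rw [Matrix.cstar_norm_def]
      refine ContinuousLinearMap.opNorm_le_bound _ (by positivity) fun y => ?_
      have h7 := h5 (Matrix.toEuclideanCLM (𝕜 := ℂ) (resolvent (MatrixModel.h n p α α' β β') z) y)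
      have h8 : A * resolvent (MatrixModel.h n p α α' β β') z = 1 := Ring.mul_inverse_cancel _ hu
      rw [← mul_apply_eq_comp, ← map_mul, h8, map_one] at h7
      rw [div_mul_eq_mul_div, le_div_iff₀ h4, mul_comm]
      exact h7
    have h9 := hz.trans h6
    rw [div_le_div_iff₀ hε h4] at h9
    linarith

/-- If all of σ(H_θ) were at distance at least C/√n from z, a kernel vector x of z - h_n would
satisfy ‖x‖ ≤ (20M/C)‖x‖; strictness of 20M < C forces x = 0. -/
theorem subsetWithin_spectrum_h {α α' β β' : ℂ} {M C θ : ℝ} {p : ℤ} {n : ℕ} (hn : 1 ≤ n)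
    (hp : |θ - (p : ℝ) / (n : ℝ)| ≤ 1 / (2 * (n : ℝ)))
    (hα : ‖α‖ ≤ M) (hα' : ‖α'‖ ≤ M) (hβ : ‖β‖ ≤ M) (hβ' : ‖β'‖ ≤ M)
    (hC : 20 * M < C) (hN : IsStarNormal (RotationAlgebra.H.{u} θ α α' β β')) :
    SubsetWithin (C / Real.sqrt n) (spectrum ℂ (MatrixModel.h n p α α' β β'))
      (spectrum ℂ (RotationAlgebra.H.{u} θ α α' β β')) := by
  intro z hz
  by_contra! hcon
  have hsq : 0 < Real.sqrt n := Real.sqrt_pos.mpr (by exact_mod_cast hn)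
  have hM : 0 ≤ M := (norm_nonneg _).trans hα
  have hC0 : 0 < C / Real.sqrt n := div_pos (by linarith) hsq
  obtain ⟨h1, h2⟩ := norm_resolvent_le_of_normal hC0 hcon
  have key := MatrixModel.norm_le_resolvent_H.{u} hn hp hα hα' hβ hβ' h1
  refine hz (Matrix.isUnit_of_toEuclideanCLM_injective fun x hx => ?_)
  have h3 := key x
  rw [hx, norm_zero, zero_add] at h3
  by_contra hx0
  have hx' : 0 < ‖x‖ := norm_pos_iff.mpr hx0
  have h4 : 20 * M / Real.sqrt n < C / Real.sqrt n := by gcongr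
  have h5 : ‖x‖ ≤ 1 / (C / Real.sqrt n) * (20 * M / Real.sqrt n * ‖x‖) :=
    h3.trans (mul_le_mul_of_nonneg_right h2 (by positivity))
  rw [one_div, ← div_eq_inv_mul, le_div_iff₀ hC0] at h5
  nlinarith

theorem theorem5p2 (α₁ α₁' β₁ β₁' : ℂ) (M : ℝ)
    (hM : M = max (max ‖α₁‖ ‖α₁'‖) (max ‖β₁‖ ‖β₁'‖)) :
    ∃ C₁ : ℝ, 0 ≤ C₁ ∧ C₁ ≤ 36 * M * Real.sqrt (3 * Real.pi) ∧
      ∀ θ : ℝ, 0 < θ → θ < 1 → Irrational θ →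
      ∀ p : ℕ → ℤ, (∀ n : ℕ, 1 ≤ n → |θ - (p n : ℝ) / (n : ℝ)| ≤ 1 / (2 * (n : ℝ))) →
      ∀ n : ℕ, 1 ≤ n →
        (∀ ε : ℝ, 0 < ε →
          pseudospectrum ε (MatrixModel.h n (p n) α₁ α₁' β₁ β₁') ⊆
            pseudospectrum (ε + C₁ / Real.sqrt n) (RotationAlgebra.H.{u} θ α₁ α₁' β₁ β₁')) ∧
        (0 < M → IsStarNormal (RotationAlgebra.H.{u} θ α₁ α₁' β₁ β₁') →
          SubsetWithin (C₁ / Real.sqrt n)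
            (spectrum ℂ (MatrixModel.h n (p n) α₁ α₁' β₁ β₁'))
            (spectrum ℂ (RotationAlgebra.H.{u} θ α₁ α₁' β₁ β₁'))) := by
  have hα : ‖α₁‖ ≤ M := by simp [hM]
  have hα' : ‖α₁'‖ ≤ M := by simp [hM]
  have hβ : ‖β₁‖ ≤ M := by simp [hM]
  have hβ' : ‖β₁'‖ ≤ M := by simp [hM]
  have hM0 : 0 ≤ M := (norm_nonneg _).trans hα
  -- Any multiple of M with factor above 20 and at most 36√(3π) would serve; 36 is convenient since
  -- √(3π) ≥ 1. The strict 20M < C₁ is where M > 0 enters.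
  refine ⟨36 * M, by positivity, ?_, fun θ _ _ _ p hp n hn => ⟨fun ε hε => ?_, fun hMpos hN => ?_⟩⟩
  · have : (1 : ℝ) ≤ Real.sqrt (3 * Real.pi) :=
      Real.one_le_sqrt.mpr (by linarith [Real.pi_gt_three])
    exact le_mul_of_one_le_right (by positivity) this
  · exact pseudospectrum_h_subset hn (hp n hn) hα hα' hβ hβ' (by linarith) hε
  · exact subsetWithin_spectrum_h hn (hp n hn) hα hα' hβ hβ' (by linarith) hN
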